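/- **Definitions.** A *tract* is a commutative monoid $F$ with absorbing element $0$ and unit group $F^\times=F\setminus\{0\}$, together with a subset $N_F$ of the group semiring $\mathbb N[F^\times]$ such that $0\in N_F$, $1\notin N_F$, there is a unique $\epsilon\in F^\times$ with $1+\epsilon\in N_F$, and $N_F$ is stable under multiplication by $F^\times$. Zero terms are dropped when a sum of elements of $F$ is read in $\mathbb N[F^\times]$. Fix an involution $\tau$ of $F$, i.e. a multiplicative map $\tau:F\to F$, $a\mapsto\overline a$, with $\tau(0)=0$, $\tau(1)=1$, $\tau^2=\mathrm{id}$, such that $\sum \overline{a_i}\in N_F$ whenever $\sum a_i\in N_F$. Let $E=\{1,\dots,n\}$. For $\mu:E^r\to F$ and $\nu:E^w\to F$, the *Plücker flag relations* for $(\mu,\nu)$ are $$\sum_{k=1}^{w+1}\epsilon^k\,\nu(y_1,\dots,\widehat{y_k},\dots,y_{w+1})\,\mu(y_k,x_1,\dots,x_{r-1})\in N_F\qquad\text{for all }y_1,\dots,y_{w+1},x_1,\dots,x_{r-1}\in E$$ (there are none if $r=0$). A *Grassmann–Plücker function* of rank $r$ on $E$ is a function $\varphi:E^r\to F$ that is not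 identically zero, is alternating (interchanging two entries multiplies the value by $\epsilon$, and the value is $0$ if two entries are equal), and satisfies the Plücker flag relations for $(\varphi,\varphi)$. An *$F$-matroid* $M=[\varphi]$ is a class of Grassmann–Plücker functions up to multiplication by elements of $F^\times$. Its bases are the sets $\{x_1,\dots,x_r\}$ with $\varphi(x_1,\dots,x_r)\neq0$, and its underlying circuits are the minimal subsets of $E$ that are contained in no basis. The set $\mathcal C(M)\subseteq F^E$ of *$F$-circuits* consists of the elements $aX_C$ with $a\in F^\times$ and $C$ an underlying circuit, where for $y_0\in C$ and a basis $\{y_1,\dots,y_r\}\supseteq C\setminus\{y_0\}$ one sets $X_C(y_i)=\epsilon^i\varphi(y_0,\dots,\widehat{y_i},\dots,y_r)$ and $X_C(e)=0$ for $e\notin\{y_0,\dots,y_r\}$. The *dual* is $M^*=[\varphi^*]$, where $\varphi^*:E^{n-r}\to F$ is given by $\varphi^*(x_1,\dots,x_{n-r})=\operatorname{sign}(x_1,\dots,x_{n-r},x_1',\dots,x_r')\,\overline{\varphi(x_1',\dots,x_r')}$ whenever $E=\{x_1,\dots,x_{n-r},x'_1,\dots,x'_r\}$ (with $-1$ read as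 $\epsilon$) and vanishes if the $x_i$ are not distinct; put $\mathcal C^*(M)=\mathcal C(M^*)$. For $X,Y\in F^E$ write $X\perp Y$ if $\sum_{e\in E}X_e\overline{Y_e}\in N_F$, and let $\mathcal X^\perp=\{X\in F^E\mid X\perp Y\text{ for all }Y\in\mathcal X\}$. The sets of *vectors* and *covectors* of $M$ are $\mathcal V(M)=\mathcal C^*(M)^\perp$ and $\mathcal V^*(M)=\mathcal C(M)^\perp$. The tract $F$ (with $\tau$) is *perfect* if $X\perp Y$ for every $F$-matroid $M$ (on any $\{1,\dots,n\}$), all $X\in\mathcal V(M)$ and all $Y\in\mathcal V^*(M)$. For $F$-matroids $M,N$ on $E$, $M$ is a *quotient* of $N$, written $N\twoheadrightarrow M$, if for all Grassmann–Plücker functions $\mu,\nu$ with $M=[\mu]$ and $N=[\nu]$ the Plücker flag relations for $(\mu,\nu)$ hold. A sequence $(M_1,\dots,M_s)$ of $F$-matroids on $E$ is a *flag $F$-matroid* if $M_j\twoheadrightarrow M_i$ for all $1\le i<j\le s$. **Theorem.** Let $F$ be a tract with an involution $\tau$, and let $M_1,\dots,M_s$ be $F$-matroids on $E=\{1,\dots,n\}$.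 Consider the following properties: 1. $\mathcal V^*(M_1)\subseteq\dots\subseteq\mathcal V^*(M_s)$; 2. $(M_1,\dots,M_s)$ is a flag $F$-matroid; 3. $M_i$ is a quotient of $M_{i+1}$ for all $1\le i\le s-1$. Then (1)$\Rightarrow$(2)$\Rightarrow$(3), and if $F$ is perfect, then also (3)$\Rightarrow$(1). In particular, if $F$ is perfect and $\varphi_1,\dots,\varphi_s$ are Grassmann–Plücker functions with $M_i=[\varphi_i]$, then $(M_1,\dots,M_s)$ is a flag $F$-matroid if and only if the Plücker flag relations for $(\varphi_i,\varphi_{i+1})$ hold for all $1\le i\le s-1$. -/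

import Mathlib

noncomputable section

namespace FlagMat

/-- A tract: a commutative pointed monoid `F` whose unit group is `F - {0}` (that is, a commutative
group with zero), together with a nullset `N_F` in the group semiring `ℕ[Fˣ]`. -/
class Tract (F : Type*) extends CommGroupWithZero F where
  nullset : Set (MonoidAlgebra ℕ Fˣ)
  zero_mem : 0 ∈ nullset
  one_notMem : 1 ∉ nullset
  existsUnique_eps : ∃! e : Fˣ, 1 + MonoidAlgebra.single e 1 ∈ nullset
  smul_mem : ∀ (a : Fˣ) (s : MonoidAlgebra ℕ Fˣ), s ∈ nullset →
    MonoidAlgebra.single a 1 * s ∈ nullset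

section Tract

variable (F : Type*) [Tract F]

/-- The element `ε` of `Fˣ`, regarded as an element of `F`. -/
def eps : F := ((Tract.existsUnique_eps (F := F)).choose : F)

variable {F}

open Classical in
/-- An element of `F` as an element of `ℕ[Fˣ]`; the zero of `F` becomes the zero of `ℕ[Fˣ]`. -/
def formalTerm (a : F) : MonoidAlgebra ℕ Fˣ :=
  if h : a = 0 then 0 else MonoidAlgebra.single (Units.mk0 a h) 1

/-- The formal sum `∑ i, a i`, an element of `ℕ[Fˣ]`, belongs to the nullset. -/
def IsNull {ι : Type*} [Fintype ι] (a : ι → F) : Prop :=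
  ∑ i, formalTerm (a i) ∈ Tract.nullset (F := F)

variable (F) in
/-- A sign `±1` as an element of `F`, where `-1` is identified with `ε`. -/
def signElt (u : ℤˣ) : F := if u = 1 then 1 else eps F

end Tract

/-- Morphisms of tracts. -/
structure TractHom (F G : Type*) [Tract F] [Tract G] extends F →*₀ G where
  map_nullset : ∀ s ∈ Tract.nullset (F := F),
    MonoidAlgebra.mapDomain (Units.map (toMonoidWithZeroHom : F →* G)) s ∈ Tract.nullset (F := G)

/-- An involution of a tract: a tract endomorphism whose square is the identity. -/
structure Involution (F : Type*) [Tract F] extends TractHom F F where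
  apply_apply : ∀ a, toMonoidWithZeroHom (toMonoidWithZeroHom a) = a

instance (F : Type*) [Tract F] : CoeFun (Involution F) (fun _ => F → F) :=
  ⟨fun τ => τ.toMonoidWithZeroHom⟩

section Pluecker

variable {F : Type*} [Tract F] {n r w : ℕ}

/-- The Plücker flag relations between `μ : E^r → F` and `ν : E^w → F`, where `E = Fin n`:
`∑ k, ε^k ν(y₁, …, ŷₖ, …, y_{w+1}) μ(yₖ, x₁, …, x_{r-1}) ∈ N_F` for all `y₁, …, y_{w+1}` and
`x₁, …, x_{r-1}` in `E`. The number `m` is `r - 1`; for `r = 0` there are no such relations.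
The index `k` starts at `0` here, hence the exponent `k + 1`. -/
def PluckerFlagRelations (μ : (Fin r → Fin n) → F) (ν : (Fin w → Fin n) → F) : Prop :=
  ∀ (m : ℕ) (hm : r = m + 1) (y : Fin (w + 1) → Fin n) (x : Fin m → Fin n),
    IsNull fun k : Fin (w + 1) =>
      eps F ^ ((k : ℕ) + 1) * ν (fun i => y (k.succAbove i)) *
        μ (fun i => (Fin.cons (y k) x : Fin (m + 1) → Fin n) (Fin.cast hm i))

variable (F n r) in
/-- Grassmann–Plücker functions of rank `r` on `E = Fin n` with coefficients in `F`. -/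
structure GPFunction where
  toFun : (Fin r → Fin n) → F
  exists_ne_zero : ∃ x, toFun x ≠ 0
  swap : ∀ (x : Fin r → Fin n) (i j : Fin r), i ≠ j →
    toFun (x ∘ Equiv.swap i j) = eps F * toFun x
  eq_zero : ∀ (x : Fin r → Fin n) (i j : Fin r), i ≠ j → x i = x j → toFun x = 0
  plucker : PluckerFlagRelations toFun toFun

theorem GPFunction.rank_le (φ : GPFunction F n r) : r ≤ n := by
  obtain ⟨x, hx⟩ := φ.exists_ne_zero
  have hinj : Function.Injective x := by
    intro i j hij
    by_contra hne
    exact hx (φ.eq_zero x i j hne hij)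
  simpa using Fintype.card_le_of_injective x hinj

variable (F n r) in
/-- Two Grassmann–Plücker functions are equivalent if they differ by a factor in `Fˣ`. -/
instance GPFunction.setoid : Setoid (GPFunction F n r) where
  r φ ψ := ∃ a : Fˣ, ∀ x, φ.toFun x = a * ψ.toFun x
  iseqv := by
    refine ⟨fun φ => ⟨1, fun x => by simp⟩, ?_, ?_⟩
    · rintro φ ψ ⟨a, h⟩
      exact ⟨a⁻¹, fun x => by rw [h x, Units.inv_mul_cancel_left]⟩
    · rintro φ ψ χ ⟨a, h⟩ ⟨b, h'⟩
      exact ⟨a * b, fun x => by rw [h x, h' x, Units.val_mul, mul_assoc]⟩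

end Pluecker

/-- An `F`-matroid on `E = Fin n`: an equivalence class of Grassmann–Plücker functions. -/
structure FMatroid (F : Type*) [Tract F] (n : ℕ) where
  rank : ℕ
  cls : Quotient (GPFunction.setoid F n rank)

namespace FMatroid

variable {F : Type*} [Tract F] {n : ℕ}

/-- `φ` is a Grassmann–Plücker function with `M = [φ]`. -/
def Represents {M : FMatroid F n} (φ : GPFunction F n M.rank) : Prop := M.cls = ⟦φ⟧

/-- `M` is a quotient of `N` (written `N ↠ M`). -/
def IsQuotientOf (M N : FMatroid F n) : Prop :=
  ∀ (μ : GPFunction F n M.rank) (ν : GPFunction F n N.rank), Represents μ → Represents ν →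
    PluckerFlagRelations μ.toFun ν.toFun

end FMatroid

/-- A sequence of `F`-matroids is a flag `F`-matroid if `M j ↠ M i` for all `i < j`. -/
def IsFlagMatroid {F : Type*} [Tract F] {n s : ℕ} (M : Fin s → FMatroid F n) : Prop :=
  ∀ i j, i < j → (M i).IsQuotientOf (M j)

section Circuits

variable {F : Type*} [Tract F] {n r : ℕ}

/-- The bases of the underlying matroid: the sets `{x₁, …, x_r}` with `φ(x₁, …, x_r) ≠ 0`. -/
def IsBasis (φ : (Fin r → Fin n) → F) (B : Set (Fin n)) : Prop :=
  ∃ x : Fin r → Fin n, φ x ≠ 0 ∧ B = Set.range x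

/-- The circuits of the underlying matroid: the minimal dependent sets, where a set is dependent
if no basis contains it. -/
def IsCircuitSet (φ : (Fin r → Fin n) → F) (C : Set (Fin n)) : Prop :=
  Minimal (fun D : Set (Fin n) => ¬ ∃ B, IsBasis φ B ∧ D ⊆ B) C

/-- The set of `F`-circuits defined by `φ`: the elements `a • X_C` for `a ∈ Fˣ` and a circuit `C` of
the underlying matroid, where `y₀ ∈ C`, where `{y₁, …, y_r}` is a basis containing `C - y₀`, and
`X_C(y_i) = ε^i φ(y₀, …, ŷ_i, …, y_r)` and `X_C = 0` off `{y₀, …, y_r}`. -/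
def circuitsOf (φ : (Fin r → Fin n) → F) : Set (Fin n → F) :=
  {X | ∃ (C : Set (Fin n)) (y : Fin (r + 1) → Fin n) (a : Fˣ),
    IsCircuitSet φ C ∧ y 0 ∈ C ∧ φ (fun i => y i.succ) ≠ 0 ∧
    C \ {y 0} ⊆ Set.range (fun i : Fin r => y i.succ) ∧
    (∀ i : Fin (r + 1), X (y i) = a * (eps F ^ (i : ℕ) * φ (fun j => y (i.succAbove j)))) ∧
    ∀ e, e ∉ Set.range y → X e = 0}

end Circuits

section Dual

variable {F : Type*} [Tract F] {n r : ℕ}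

/-- For a permutation `(π 0, …, π (n-1))` of `E = Fin n`, its first `n - r` entries. -/
def firstPart (r : ℕ) (π : Equiv.Perm (Fin n)) : Fin (n - r) → Fin n :=
  fun i => π (i.castLE (Nat.sub_le n r))

/-- For a permutation `(π 0, …, π (n-1))` of `E = Fin n`, its last `r` entries. -/
def lastPart (h : r ≤ n) (π : Equiv.Perm (Fin n)) : Fin r → Fin n :=
  fun j => π ⟨n - r + j, by omega⟩

open Classical in
/-- The dual `φ* : E^(n-r) → F` of a Grassmann–Plücker function `φ`, determined by
`φ*(x₁, …, x_{n-r}) = sign(x₁, …, x_{n-r}, x'₁, …, x'_r) · τ(φ(x'₁, …, x'_r))` whenever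
`E = {x₁, …, x_{n-r}, x'₁, …, x'_r}`, and by `φ*(x) = 0` if the entries of `x` are not distinct. -/
def GPFunction.dual (τ : Involution F) (φ : GPFunction F n r) (x : Fin (n - r) → Fin n) : F :=
  if h : ∃ π : Equiv.Perm (Fin n), firstPart r π = x then
    signElt F (Equiv.Perm.sign h.choose) * τ (φ.toFun (lastPart φ.rank_le h.choose))
  else 0

theorem one_add_eps : (1 : MonoidAlgebra ℕ Fˣ) +
    MonoidAlgebra.single (Tract.existsUnique_eps (F := F)).choose 1 ∈
    Tract.nullset (F := F) := (Tract.existsUnique_eps (F := F)).choose_spec.1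

theorem eps_unique (e : Fˣ) (h : 1 + MonoidAlgebra.single e 1 ∈ Tract.nullset (F := F)) :
    (e : F) = eps F := congrArg _ ((Tract.existsUnique_eps (F := F)).choose_spec.2 e h)

theorem eps_mul_eps : eps F * eps F = 1 := by
  set e := (Tract.existsUnique_eps (F := F)).choose with he
  have h := Tract.smul_mem e⁻¹ _ (one_add_eps (F := F))
  rw [mul_add, mul_one, MonoidAlgebra.single_mul_single, inv_mul_cancel, add_comm] at h
  have := eps_unique e⁻¹ (by simpa [MonoidAlgebra.one_def] using h)
  rw [← this]
  nth_rewrite 2 [this]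
  exact (Units.inv_mul e)

theorem map_eps (τ : Involution F) : τ (eps F) = eps F := by
  obtain ⟨e, he, h0⟩ : ∃ e : Fˣ, (e : F) = eps F ∧
      1 + MonoidAlgebra.single e 1 ∈ Tract.nullset (F := F) := ⟨_, rfl, one_add_eps⟩
  have h := τ.map_nullset _ h0
  rw [← he]
  rw [MonoidAlgebra.one_def, MonoidAlgebra.mapDomain_add, MonoidAlgebra.mapDomain_single,
    MonoidAlgebra.mapDomain_single, map_one] at h
  exact (eps_unique _ h).trans he.symm

theorem signElt_mul (u v : ℤˣ) : signElt F (u * v) = signElt F u * signElt F v := by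
  rcases Int.units_eq_one_or u with rfl | rfl <;> rcases Int.units_eq_one_or v with rfl | rfl <;>
    simp [signElt, eps_mul_eps]

theorem signElt_mul_self (u : ℤˣ) : signElt F u * signElt F u = 1 := by
  rw [← signElt_mul, Int.units_mul_self]; simp [signElt]

theorem map_signElt (τ : Involution F) (u : ℤˣ) : τ (signElt F u) = signElt F u := by
  unfold signElt
  split_ifs
  · exact map_one _
  · exact map_eps τ

theorem GPFunction.perm (φ : GPFunction F n r) (σ : Equiv.Perm (Fin r)) :
    ∀ x, φ.toFun (x ∘ σ) = signElt F (Equiv.Perm.sign σ) * φ.toFun x := by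
  induction σ using Equiv.Perm.swap_induction_on with
  | one => intro x; simp [signElt]
  | swap_mul f i j hij ih =>
    intro x
    rw [Equiv.Perm.coe_mul, ← Function.comp_assoc, ih, φ.swap _ _ _ hij, Equiv.Perm.sign_mul, signElt_mul,
      Equiv.Perm.sign_swap hij]
    simp [signElt, mul_left_comm, mul_assoc]

/-- The formula that determines `φ*`; it does not depend on the order of `x'₁, …, x'_r`. -/
theorem GPFunction.dual_firstPart (τ : Involution F) (φ : GPFunction F n r)
    (π : Equiv.Perm (Fin n)) : φ.dual τ (firstPart r π) =
      signElt F (Equiv.Perm.sign π) * τ (φ.toFun (lastPart φ.rank_le π)) := by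
  have hr := φ.rank_le
  have h : ∃ π' : Equiv.Perm (Fin n), firstPart r π' = firstPart r π := ⟨π, rfl⟩
  rw [GPFunction.dual, dif_pos h]
  have h' := h.choose_spec
  generalize h.choose = π' at h'
  let e : Fin r ≃ {i : Fin n // n - r ≤ (i : ℕ)} :=
    { toFun := fun j => ⟨⟨n - r + j, by omega⟩, by simp⟩
      invFun := fun i => ⟨(i : ℕ) - (n - r), by have := i.1.2; have := i.2; omega⟩
      left_inv := fun j => by ext; simp
      right_inv := fun i => by ext; simp; have := i.2; omega }
  have hfix : ∀ i : Fin n, ¬ (n - r ≤ (i : ℕ)) → (π⁻¹ * π') i = i := by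
    intro i hi
    have := congrFun h' ⟨i, by omega⟩
    rw [Equiv.Perm.mul_apply, Equiv.Perm.inv_eq_iff_eq]
    exact this
  have hmem : ∀ i : Fin n, (n - r ≤ ((π⁻¹ * π') i : ℕ)) ↔ n - r ≤ (i : ℕ) := by
    intro i
    by_cases hi : n - r ≤ (i : ℕ)
    · refine iff_of_true ?_ hi
      by_contra hc
      have := (π⁻¹ * π').injective (hfix _ hc)
      rw [this] at hc
      exact hc hi
    · rw [hfix i hi]
  let σ := Equiv.Perm.subtypePerm (p := fun i : Fin n => n - r ≤ (i : ℕ)) (π⁻¹ * π') hmem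
  have hsign : Equiv.Perm.sign (e.symm.permCongr σ) = Equiv.Perm.sign (π⁻¹ * π') := by
    rw [Equiv.Perm.sign_permCongr, Equiv.Perm.sign_subtypePerm]
    intro i hi
    by_contra hc
    exact hi (hfix i hc)
  have hlast : lastPart hr π' = lastPart hr π ∘ e.symm.permCongr σ := by
    funext j
    have : (⟨n - r + (e.symm.permCongr σ j : ℕ), by omega⟩ : Fin n) = (π⁻¹ * π') ⟨n - r + j, by omega⟩ := by
      have h2 : (e (e.symm.permCongr σ j) : Fin n) = σ (e j) := by simp [Equiv.permCongr_apply]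
      exact h2
    simp only [lastPart, Function.comp_apply]
    rw [this]; simp
  have hs : Equiv.Perm.sign π' * Equiv.Perm.sign (π⁻¹ * π') = Equiv.Perm.sign π := by
    rw [Equiv.Perm.sign_mul, Equiv.Perm.sign_inv, mul_left_comm, Int.units_mul_self, mul_one]
  rw [hlast, φ.perm, map_mul, map_signElt, hsign, ← mul_assoc, ← signElt_mul, hs]

end Dual

section Orthogonality

variable {F : Type*} [Tract F] {n : ℕ}

/-- `X ⊥ Y`: the formal sum `∑ e, X_e · τ(Y_e)` lies in the nullset. -/
def Orth (τ : Involution F) (X Y : Fin n → F) : Prop := IsNull fun e => X e * τ (Y e)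

/-- The orthogonal complement of a subset of `F^E`. -/
def orthCompl (τ : Involution F) (S : Set (Fin n → F)) : Set (Fin n → F) :=
  {X | ∀ Y ∈ S, Orth τ X Y}

namespace FMatroid

/-- The set `C(M)` of `F`-circuits of `M`. -/
def circuits (M : FMatroid F n) : Set (Fin n → F) :=
  {X | ∃ φ : GPFunction F n M.rank, Represents φ ∧ X ∈ circuitsOf φ.toFun}

/-- The set `C*(M) = C(M*)` of `F`-cocircuits of `M`, where `M* = [φ*]` for `M = [φ]`. -/
def cocircuits (τ : Involution F) (M : FMatroid F n) : Set (Fin n → F) :=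
  {X | ∃ φ : GPFunction F n M.rank, Represents φ ∧ X ∈ circuitsOf (φ.dual τ)}

/-- The set `V(M) = C*(M)^⊥` of `F`-vectors of `M`. -/
def vectors (τ : Involution F) (M : FMatroid F n) : Set (Fin n → F) :=
  orthCompl τ (M.cocircuits τ)

/-- The set `V*(M) = C(M)^⊥` of `F`-covectors of `M`. -/
def covectors (τ : Involution F) (M : FMatroid F n) : Set (Fin n → F) :=
  orthCompl τ M.circuits

end FMatroid

/-- `F` (with the involution `τ`) is perfect: `V(M) ⊥ V*(M)` for every `F`-matroid `M`. -/
def IsPerfect (τ : Involution F) : Prop :=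
  ∀ (n : ℕ) (M : FMatroid F n), ∀ X ∈ M.vectors τ, ∀ Y ∈ M.covectors τ, Orth τ X Y

end Orthogonality

end FlagMat

end

/-! The Plücker flag relations for `(μ, ν)` say exactly that the cocircuits of `[μ]` are orthogonal
to the circuits of `[ν]`. Up to units, a circuit of `ν` is the family of signed minors of a tuple
`y` extended by zero, and a cocircuit of `μ` is `e ↦ τ (μ (e, x))`; pairing the two gives the
relation for `(y, x)`, up to a unit and `τ`. This is `orth_circuitsOf_iff_pluckerFlagRelations`; of
`φ*` it needs only that it is alternating.

Hence `N ↠ M` iff `C*(M) ⊥ C(N)`. The relations for `(φ, φ)` give `C*(M) ⊆ V*(M)`, so `V*(M) ⊆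
V*(N)` implies `N ↠ M`. Conversely `N ↠ M` means `C(N) ⊆ C*(M)^⊥ = V(M)`; over a perfect tract `V(M)
⊥ V*(M)`, so `V*(M) ⊆ C(N)^⊥ = V*(N)`. Inclusions compose, which takes consecutive indices to all
pairs. -/

namespace FlagMat

open Equiv

/-! ### Null sums and signs -/

section Null

variable {F : Type*} [Tract F]

theorem exists_unit_eps : ∃ e : Fˣ, (e : F) = eps F ∧
    1 + MonoidAlgebra.single e 1 ∈ Tract.nullset (F := F) := ⟨_, rfl, one_add_eps⟩

theorem formalTerm_zero : formalTerm (0 : F) = 0 := by simp [formalTerm]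

theorem formalTerm_unit (u : Fˣ) : formalTerm (u : F) = MonoidAlgebra.single u 1 := by
  simp [formalTerm]

theorem formalTerm_unit_mul (u : Fˣ) (a : F) :
    formalTerm ((u : F) * a) = MonoidAlgebra.single u 1 * formalTerm a := by
  rcases eq_or_ne a 0 with rfl | ha
  · simp [formalTerm_zero]
  · lift a to Fˣ using ha.isUnit
    rw [← Units.val_mul, formalTerm_unit, formalTerm_unit, MonoidAlgebra.single_mul_single, mul_one]

theorem mapDomain_formalTerm (τ : Involution F) (a : F) :
    MonoidAlgebra.mapDomain (Units.map (τ.toMonoidWithZeroHom : F →* F)) (formalTerm a) =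
      formalTerm (τ a) := by
  rcases eq_or_ne a 0 with rfl | ha
  · simp [formalTerm_zero]
  · lift a to Fˣ using ha.isUnit
    rw [formalTerm_unit, MonoidAlgebra.mapDomain_single]
    exact (formalTerm_unit _).symm

theorem formalTerm_add_eps_mem (a : F) :
    formalTerm (eps F * a) + formalTerm a ∈ Tract.nullset (F := F) := by
  rcases eq_or_ne a 0 with rfl | ha
  · simpa [formalTerm_zero] using Tract.zero_mem
  · lift a to Fˣ using ha.isUnit
    obtain ⟨e, he, h⟩ := exists_unit_eps (F := F)
    have := Tract.smul_mem a _ h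
    rwa [mul_add, mul_one, MonoidAlgebra.single_mul_single, mul_one, add_comm, mul_comm a e,
      ← formalTerm_unit, ← formalTerm_unit, Units.val_mul, he] at this

theorem isNull_unit_mul {ι : Type*} [Fintype ι] (c : Fˣ) {f : ι → F} :
    IsNull (fun i => (c : F) * f i) ↔ IsNull f := by
  have key : ∀ (c : Fˣ) (f : ι → F), IsNull f → IsNull fun i => (c : F) * f i := by
    intro c f h
    have := Tract.smul_mem c _ h
    rw [Finset.mul_sum] at this
    simpa only [IsNull, formalTerm_unit_mul] using this
  exact ⟨fun h => by simpa using key c⁻¹ _ h, key c f⟩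

theorem isNull_map (τ : Involution F) {ι : Type*} [Fintype ι] {f : ι → F} :
    IsNull (fun i => τ (f i)) ↔ IsNull f := by
  have hsum : ∀ (s : Finset ι) (f : ι → F),
      MonoidAlgebra.mapDomain (Units.map (τ.toMonoidWithZeroHom : F →* F))
        (∑ i ∈ s, formalTerm (f i)) = ∑ i ∈ s, formalTerm (τ (f i)) := by
    intro s f
    induction s using Finset.cons_induction with
    | empty => simp
    | cons a s ha ih =>
      rw [Finset.sum_cons, Finset.sum_cons, MonoidAlgebra.mapDomain_add, ih, mapDomain_formalTerm]
  have key : ∀ f : ι → F, IsNull f → IsNull fun i => τ (f i) := by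
    intro f h
    have := τ.map_nullset _ h
    rwa [hsum] at this
  exact ⟨fun h => by simpa only [τ.apply_apply] using key _ h, key f⟩

theorem isNull_comp_injective {ι κ : Type*} [Fintype ι] [Fintype κ] {y : ι → κ}
    (hy : Function.Injective y) {f : κ → F} (hf : ∀ e, e ∉ Set.range y → f e = 0) :
    IsNull (fun i => f (y i)) ↔ IsNull f := by
  have h : ∑ i, formalTerm (f (y i)) = ∑ e, formalTerm (f e) :=
    Fintype.sum_of_injective y hy _ _ (fun e he => by rw [hf e he, formalTerm_zero])
      (fun _ => rfl)
  rw [IsNull, IsNull, h]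

theorem isNull_of_forall_eq_zero {ι : Type*} [Fintype ι] {f : ι → F} (h : ∀ i, f i = 0) :
    IsNull f := by
  simpa [IsNull, h, formalTerm_zero] using Tract.zero_mem

theorem isNull_of_pair {ι : Type*} [Fintype ι] {f : ι → F} {i j : ι} (hij : i ≠ j)
    (h : f i = eps F * f j) (h0 : ∀ k, k ≠ i → k ≠ j → f k = 0) : IsNull f := by
  rw [IsNull, Fintype.sum_eq_add i j hij
    (fun k hk => by rw [h0 k hk.1 hk.2, formalTerm_zero]), h]
  exact formalTerm_add_eps_mem _

theorem signElt_ne_zero (u : ℤˣ) : signElt F u ≠ 0 := by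
  intro h
  simpa [h] using signElt_mul_self (F := F) u

theorem eps_ne_zero : eps F ≠ 0 := by
  intro h
  simpa [h] using eps_mul_eps (F := F)

theorem signElt_neg_one_pow (k : ℕ) : signElt F ((-1) ^ k) = eps F ^ k := by
  induction k with
  | zero => simp [signElt]
  | succ k ih => rw [pow_succ, signElt_mul, ih, pow_succ]; simp [signElt]

end Null

/-! ### Signed minors and circuits of alternating functions -/

section Alternating

variable {F : Type*} [Tract F] {n r w : ℕ}

/-- Functions that take the sign of a permutation of the arguments as a factor and vanish unless
the arguments are distinct. -/
structure IsAlternating (ψ : (Fin w → Fin n) → F) : Prop where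
  perm : ∀ (σ : Perm (Fin w)) (x : Fin w → Fin n),
    ψ (x ∘ σ) = signElt F (Perm.sign σ) * ψ x
  injective : ∀ x, ψ x ≠ 0 → Function.Injective x

theorem GPFunction.isAlternating (φ : GPFunction F n r) : IsAlternating φ.toFun where
  perm := φ.perm
  injective x hx i j hij := by
    by_contra hne
    exact hx (φ.eq_zero x i j hne hij)

/-- The value `ε^k ψ(y₀, …, ŷₖ, …, y_w)`. -/
noncomputable def signedMinor (ψ : (Fin w → Fin n) → F) (y : Fin (w + 1) → Fin n)
    (k : Fin (w + 1)) : F :=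
  eps F ^ (k : ℕ) * ψ (fun j => y (k.succAbove j))

theorem signedMinor_ne_zero {ψ : (Fin w → Fin n) → F} {y : Fin (w + 1) → Fin n}
    {k : Fin (w + 1)} : signedMinor ψ y k ≠ 0 ↔ ψ (fun j => y (k.succAbove j)) ≠ 0 := by
  simp [signedMinor, eps_ne_zero]

namespace IsAlternating

variable {ψ : (Fin w → Fin n) → F}

/-- With `k = ρ 0`, `ρ` is a permutation fixing `0` followed by the inverse of `k.cycleRange`. That
inverse sends `j.succ` to `k.succAbove j` and has sign `(-1)^k`, which accounts for the factor
`ε^k`. -/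
theorem signedMinor_apply_zero (hψ : IsAlternating ψ) (y : Fin (w + 1) → Fin n)
    (ρ : Perm (Fin (w + 1))) :
    signedMinor ψ y (ρ 0) = signElt F (Perm.sign ρ) * ψ (fun j => y (ρ j.succ)) := by
  obtain ⟨⟨p, e⟩, he⟩ := Perm.decomposeFin.symm.surjective ((ρ 0).cycleRange * ρ)
  have hp : p = 0 := by
    have := congrArg (fun π : Perm (Fin (w + 1)) => π 0) he
    simpa using this
  subst hp
  have hρ : ρ = (ρ 0).cycleRange⁻¹ * Perm.decomposeFin.symm (0, e) := by
    rw [he, inv_mul_cancel_left]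
  have hs : Perm.sign ρ = (-1) ^ (ρ 0 : ℕ) * Perm.sign e := by
    conv_lhs => rw [hρ]
    rw [Perm.sign_mul, Perm.sign_inv, Fin.sign_cycleRange, Perm.decomposeFin.symm_sign]
    simp
  have hj : (fun j : Fin w => y (ρ j.succ)) = (fun j => y ((ρ 0).succAbove j)) ∘ e := by
    funext j
    have : ρ j.succ = (ρ 0).succAbove (e j) := by
      conv_lhs => rw [hρ]
      rw [Perm.mul_apply, Perm.decomposeFin_symm_apply_succ, swap_self]
      exact Fin.cycleRange_symm_succ _ _
    simp [this]
  rw [hj, hψ.perm, ← mul_assoc, ← signElt_mul, hs, mul_assoc, Int.units_mul_self, mul_one,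
    signElt_neg_one_pow, signedMinor]

theorem signedMinor_comp (hψ : IsAlternating ψ) (y : Fin (w + 1) → Fin n)
    (σ : Perm (Fin (w + 1))) (k : Fin (w + 1)) :
    signedMinor ψ (y ∘ σ) k = signElt F (Perm.sign σ) * signedMinor ψ y (σ k) := by
  have h1 := hψ.signedMinor_apply_zero (y ∘ σ) (swap 0 k)
  have h2 := hψ.signedMinor_apply_zero y (σ * swap 0 k)
  simp only [Perm.mul_apply, swap_apply_left, Function.comp_apply, Perm.sign_mul] at h1 h2
  rw [h1, h2, signElt_mul, ← mul_assoc, ← mul_assoc, signElt_mul_self, one_mul]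

/-- The underlying circuit can be forgotten: an injective tuple with a nonzero minor is a basis plus
one element, and its range contains a circuit through that element. -/
theorem mem_circuitsOf_iff (hψ : IsAlternating ψ) {X : Fin n → F} :
    X ∈ circuitsOf ψ ↔ ∃ (y : Fin (w + 1) → Fin n) (a : Fˣ), Function.Injective y ∧
      (∃ k, signedMinor ψ y k ≠ 0) ∧ (∀ i, X (y i) = a * signedMinor ψ y i) ∧
      ∀ e, e ∉ Set.range y → X e = 0 := by
  constructor
  · rintro ⟨C, y, a, hC, hy0, hy, hsub, hX, hX0⟩
    refine ⟨y, a, ?_, ⟨0, signedMinor_ne_zero.2 (by simpa using hy)⟩, hX, hX0⟩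
    -- Otherwise the dependent set `C` would lie in the basis `{y₁, …, y_w}`.
    have hnot : y 0 ∉ Set.range fun i : Fin w => y i.succ := by
      intro hmem
      refine hC.1 ⟨_, ⟨_, hy, rfl⟩, fun e he => ?_⟩
      by_cases h : e = y 0
      · rwa [h]
      · exact hsub ⟨he, h⟩
    rw [← Fin.cons_self_tail y, Fin.cons_injective_iff]
    exact ⟨hnot, hψ.injective _ hy⟩
  · rintro ⟨y, a, hinj, ⟨k, hk⟩, hX, hX0⟩
    -- The definition omits position `0` to get a basis, so an index with nonzero minor is moved
    -- there; `sign σ` is absorbed into the unit.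
    set σ : Perm (Fin (w + 1)) := swap 0 k with hσ
    have hbase : ψ (fun i : Fin w => (y ∘ σ) i.succ) ≠ 0 := by
      have : signedMinor ψ (y ∘ σ) 0 ≠ 0 := by
        rw [hψ.signedMinor_comp, hσ, swap_apply_left]
        exact mul_ne_zero (signElt_ne_zero _) hk
      simpa using signedMinor_ne_zero.1 this
    -- The range has `w + 1` elements, a basis at most `w`.
    have hdep : ¬ ∃ B, IsBasis ψ B ∧ Set.range (y ∘ σ) ⊆ B := by
      rintro ⟨_, ⟨x, _, rfl⟩, hsub⟩
      have h1 := Set.ncard_le_ncard hsub (Set.toFinite _)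
      rw [Set.ncard_range_of_injective (hinj.comp σ.injective)] at h1
      have h2 : (Set.range x).ncard ≤ w := by
        rw [← Set.image_univ]
        exact (Set.ncard_image_le Set.finite_univ).trans (by simp)
      simp at h1
      omega
    obtain ⟨C, hCsub, hC⟩ := exists_minimal_le_of_wellFoundedLT
      (fun D : Set (Fin n) => ¬ ∃ B, IsBasis ψ B ∧ D ⊆ B) _ hdep
    have hmem : ∀ e ∈ C, e ≠ (y ∘ σ) 0 → e ∈ Set.range fun i : Fin w => (y ∘ σ) i.succ := by
      intro e he hne
      obtain ⟨i, rfl⟩ := hCsub he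
      obtain ⟨j, rfl⟩ := Fin.exists_succ_eq.2 (fun h : i = 0 => hne (by rw [h]))
      exact ⟨j, rfl⟩
    have hu : (a : F) * signElt F (Perm.sign σ) ≠ 0 := mul_ne_zero a.ne_zero (signElt_ne_zero _)
    refine ⟨C, y ∘ σ, Units.mk0 _ hu, hC, ?_, hbase, fun e he => hmem e he.1 he.2, ?_, ?_⟩
    · by_contra h0
      exact hC.1 ⟨_, ⟨_, hbase, rfl⟩, fun e he => hmem e he (fun h => h0 (h ▸ he))⟩
    · intro i
      change _ = _ * signedMinor ψ (y ∘ σ) i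
      rw [Function.comp_apply, hX, hψ.signedMinor_comp, Units.val_mk0, mul_assoc,
        ← mul_assoc _ _ (signedMinor _ _ _), signElt_mul_self, one_mul]
    · intro e he
      exact hX0 e (by rwa [σ.surjective.range_comp] at he)

end IsAlternating

end Alternating

/-! ### The dual function and cocircuits -/

section Dual

variable {F : Type*} [Tract F] {n r m : ℕ} (τ : Involution F)

theorem firstPart_injective (r : ℕ) (π : Perm (Fin n)) : Function.Injective (firstPart r π) :=
  π.injective.comp (Fin.castLE_injective _)

theorem lastPart_injective (h : r ≤ n) (π : Perm (Fin n)) : Function.Injective (lastPart h π) :=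
  π.injective.comp fun i j hij => by
    have := congrArg Fin.val hij
    ext
    simp at this
    omega

theorem firstPart_ne_lastPart (h : r ≤ n) (π : Perm (Fin n)) (i : Fin (n - r)) (j : Fin r) :
    firstPart r π i ≠ lastPart h π j := by
  intro hij
  have := congrArg Fin.val (π.injective hij)
  simp at this
  omega

theorem eq_firstPart_or_eq_lastPart (h : r ≤ n) (π : Perm (Fin n)) (e : Fin n) :
    (∃ i, firstPart r π i = e) ∨ ∃ j, lastPart h π j = e := by
  obtain ⟨p, rfl⟩ := π.surjective e
  by_cases hp : (p : ℕ) < n - r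
  · exact Or.inl ⟨⟨p, hp⟩, rfl⟩
  · refine Or.inr ⟨⟨p - (n - r), by omega⟩, congrArg π ?_⟩
    ext
    simp
    omega

theorem exists_firstPart_eq {x : Fin (n - r) → Fin n} (hx : Function.Injective x) :
    ∃ π : Perm (Fin n), firstPart r π = x := by
  obtain ⟨π, hπ⟩ := Perm.exists_extending_pair _ x (Fin.castLE_injective (Nat.sub_le n r)) hx
  exact ⟨π, funext hπ⟩

theorem exists_lastPart_eq (h : r ≤ n) {x : Fin r → Fin n} (hx : Function.Injective x) :
    ∃ π : Perm (Fin n), lastPart h π = x := by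
  obtain ⟨π, hπ⟩ := Perm.exists_extending_pair _ x (lastPart_injective h 1) hx
  exact ⟨π, funext hπ⟩

theorem GPFunction.dual_isAlternating (φ : GPFunction F n r) : IsAlternating (φ.dual τ) where
  injective x hx := by
    rw [GPFunction.dual] at hx
    split_ifs at hx with h
    · obtain ⟨π, rfl⟩ := h
      exact firstPart_injective r π
    · exact absurd rfl hx
  perm σ x := by
    by_cases hx : Function.Injective x
    · obtain ⟨π, rfl⟩ := exists_firstPart_eq hx
      -- Permuting the arguments is transported to a permutation of `E` of the same sign that fixes
      -- the complementary entries.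
      set g := σ.viaFintypeEmbedding ⟨_, hx⟩ with hg
      have hfirst : firstPart r π ∘ σ = firstPart r (g * π) := by
        funext i
        exact (σ.viaFintypeEmbedding_apply_image ⟨_, hx⟩ i).symm
      have hlast : lastPart φ.rank_le (g * π) = lastPart φ.rank_le π := by
        funext j
        refine σ.viaFintypeEmbedding_apply_notMem_range ⟨_, hx⟩ ?_
        rintro ⟨i, hi⟩
        exact firstPart_ne_lastPart φ.rank_le π i j hi
      rw [hfirst, φ.dual_firstPart, φ.dual_firstPart, hlast, Perm.sign_mul, signElt_mul, hg,
        Perm.viaFintypeEmbedding_sign, mul_assoc]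
    · have h0 : ∀ z : Fin (n - r) → Fin n, ¬ Function.Injective z → φ.dual τ z = 0 := by
        intro z hz
        rw [GPFunction.dual, dif_neg]
        rintro ⟨π, rfl⟩
        exact hz (firstPart_injective r π)
      rw [h0 x hx, mul_zero, h0]
      intro h
      exact hx (by simpa [Function.comp_assoc] using h.comp σ.symm.injective)

/-- Transposing `y 0` and `y k` in `E` turns the complement `(y 0, x)` into `(y k, x)`. Its sign
cancels the one from moving index `k` to the front. -/
theorem GPFunction.signedMinor_dual (μ : GPFunction F n (m + 1)) (π : Perm (Fin n))
    (y : Fin (n - (m + 1) + 1) → Fin n) (x : Fin m → Fin n)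
    (hfirst : firstPart (m + 1) π = fun i => y i.succ)
    (hlast : lastPart μ.rank_le π = Fin.cons (y 0) x) (k : Fin (n - (m + 1) + 1)) :
    signedMinor (μ.dual τ) y k =
      signElt F (Perm.sign π) * τ (μ.toFun (Fin.cons (y k) x)) := by
  have hy : Function.Injective y := by
    rw [← Fin.cons_self_tail y, Fin.cons_injective_iff]
    refine ⟨?_, ?_⟩
    · rintro ⟨i, hi⟩
      refine firstPart_ne_lastPart μ.rank_le π i 0 ?_
      rw [hfirst, hlast]
      exact hi
    · have := firstPart_injective (m + 1) π
      rwa [hfirst] at this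
  have hxy : ∀ i j, x j ≠ y i := by
    intro i j
    refine Fin.cases ?_ (fun i => ?_) i
    · have := lastPart_injective μ.rank_le π
      rw [hlast, Fin.cons_injective_iff] at this
      exact fun h => this.1 ⟨j, h⟩
    · have := firstPart_ne_lastPart μ.rank_le π i j.succ
      rw [hfirst, hlast] at this
      simpa using this.symm
  have h0 := (μ.dual_isAlternating τ).signedMinor_apply_zero y (Equiv.swap 0 k)
  rw [swap_apply_left] at h0
  set g := Equiv.swap (y 0) (y k) with hg
  have hgy : ∀ i, g (y i) = y (Equiv.swap 0 k i) := fun i => (hy.map_swap 0 k i).symm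
  have h1 : (fun j : Fin (n - (m + 1)) => y (Equiv.swap 0 k j.succ)) =
      firstPart (m + 1) (g * π) := by
    funext j
    rw [← hgy]
    exact congrArg g (congrFun hfirst j).symm
  have h2 : lastPart μ.rank_le (g * π) = Fin.cons (y k) x := by
    funext j
    change g (lastPart μ.rank_le π j) = _
    rw [hlast]
    refine Fin.cases ?_ (fun j => ?_) j
    · simp [hg]
    · simpa [hg] using swap_apply_of_ne_of_ne (hxy 0 j) (hxy k j)
  have hs : Perm.sign g = Perm.sign (Equiv.swap 0 k) := by
    rcases eq_or_ne k 0 with rfl | hk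
    · simp [hg]
    · rw [hg, Perm.sign_swap (hy.ne hk.symm), Perm.sign_swap hk.symm]
  rw [h0, h1, μ.dual_firstPart, h2, Perm.sign_mul, signElt_mul, hs, ← mul_assoc, ← mul_assoc,
    signElt_mul_self, one_mul]

theorem GPFunction.circuitsOf_dual_zero (μ : GPFunction F n 0) {X : Fin n → F} :
    X ∉ circuitsOf (μ.dual τ) := by
  rw [(μ.dual_isAlternating τ).mem_circuitsOf_iff]
  rintro ⟨y, -, hy, -⟩
  have := Fintype.card_le_of_injective y hy
  simp at this

/-- A tuple `y` of `n - m` distinct elements has a complement of size `m`; listing it as `x` trades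
minors of `φ*` along `y` for values of `μ` at `(e, x)`. -/
theorem GPFunction.mem_circuitsOf_dual_iff (μ : GPFunction F n (m + 1)) {X : Fin n → F} :
    X ∈ circuitsOf (μ.dual τ) ↔ ∃ (x : Fin m → Fin n) (b : Fˣ),
      (∃ e, μ.toFun (Fin.cons e x) ≠ 0) ∧ ∀ e, X e = b * τ (μ.toFun (Fin.cons e x)) := by
  have hτ : ∀ a, τ a = 0 ↔ a = 0 := fun a => map_eq_zero _
  -- An element outside `y` occurs in `x`, so `(e, x)` has a repeated entry.
  have hout : ∀ (π : Perm (Fin n)) (y : Fin (n - (m + 1) + 1) → Fin n) (x : Fin m → Fin n),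
      firstPart (m + 1) π = (fun i => y i.succ) →
      lastPart μ.rank_le π = Fin.cons (y 0) x →
      ∀ e, e ∉ Set.range y → μ.toFun (Fin.cons e x) = 0 := by
    intro π y x hfirst hlast e he
    by_contra hne
    have hinj := μ.isAlternating.injective _ hne
    rw [Fin.cons_injective_iff] at hinj
    rcases eq_firstPart_or_eq_lastPart μ.rank_le π e with ⟨i, hi⟩ | ⟨j, hj⟩
    · rw [hfirst] at hi
      exact he ⟨_, hi⟩
    · rw [hlast] at hj
      revert hj
      refine Fin.cases (fun hj => he ⟨_, hj⟩) (fun j hj => hinj.1 ⟨j, hj⟩) j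
  rw [(μ.dual_isAlternating τ).mem_circuitsOf_iff]
  constructor
  · rintro ⟨y, a, hy, ⟨k, hk⟩, hX, hX0⟩
    have hn := μ.rank_le
    -- Position `n - (m + 1)` is the first of the last part: `π` places `y 0` there and the rest of
    -- `y` in the first part.
    obtain ⟨π, hπ⟩ := Perm.exists_extending_pair
      (Fin.cons ⟨n - (m + 1), by omega⟩ (Fin.castLE (Nat.sub_le n (m + 1)))) y
      (by
        rw [Fin.cons_injective_iff]
        refine ⟨?_, Fin.castLE_injective _⟩
        rintro ⟨i, hi⟩
        have := congrArg Fin.val hi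
        simp at this
        omega) hy
    have hfirst : firstPart (m + 1) π = fun i => y i.succ := funext fun i => hπ i.succ
    have hlast : lastPart μ.rank_le π = Fin.cons (y 0) (Fin.tail (lastPart μ.rank_le π)) := by
      rw [← hπ 0]
      exact (Fin.cons_self_tail _).symm
    have hm := μ.signedMinor_dual τ π y _ hfirst hlast
    refine ⟨Fin.tail (lastPart μ.rank_le π),
      Units.mk0 _ (mul_ne_zero a.ne_zero (signElt_ne_zero (Perm.sign π))), ⟨y k, ?_⟩, ?_⟩
    · rw [hm] at hk
      exact fun h => hk (by rw [h, map_zero, mul_zero])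
    · intro e
      by_cases he : e ∈ Set.range y
      · obtain ⟨i, rfl⟩ := he
        rw [hX, hm, Units.val_mk0, mul_assoc]
      · rw [hX0 e he, hout π y _ hfirst hlast e he, map_zero, mul_zero]
  · rintro ⟨x, b, ⟨e, he⟩, hX⟩
    obtain ⟨π, hlast⟩ := exists_lastPart_eq μ.rank_le (μ.isAlternating.injective _ he)
    set y : Fin (n - (m + 1) + 1) → Fin n := Fin.cons e (firstPart (m + 1) π) with hydef
    have hfirst : firstPart (m + 1) π = fun i => y i.succ := by simp [hydef]
    replace hlast : lastPart μ.rank_le π = Fin.cons (y 0) x := by simpa [hydef] using hlast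
    have hm := μ.signedMinor_dual τ π y _ hfirst hlast
    refine ⟨y, Units.mk0 _ (mul_ne_zero b.ne_zero (signElt_ne_zero (Perm.sign π))), ?_,
      ⟨0, ?_⟩, ?_, ?_⟩
    · rw [hydef, Fin.cons_injective_iff]
      refine ⟨?_, firstPart_injective _ π⟩
      rintro ⟨i, hi⟩
      refine firstPart_ne_lastPart μ.rank_le π i 0 ?_
      rw [hi, hlast]
      simp [hydef]
    · rw [hm]
      refine mul_ne_zero (signElt_ne_zero _) (mt (hτ _).1 ?_)
      simpa [hydef] using he
    · intro i
      rw [hX, hm, Units.val_mk0, mul_assoc, ← mul_assoc _ _ (τ _), signElt_mul_self, one_mul]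
    · intro e' he'
      rw [hX, hout π y x hfirst hlast e' he', map_zero, mul_zero]

end Dual

/-! ### Orthogonality and the Plücker flag relations -/

section Orthogonality

variable {F : Type*} [Tract F] {n r w : ℕ} (τ : Involution F)

theorem orth_comm {X Y : Fin n → F} : Orth τ X Y ↔ Orth τ Y X := by
  rw [Orth, ← isNull_map τ, Orth]
  simp only [map_mul, τ.apply_apply, mul_comm]

/-- If `y i = y j`, every other minor has a repeated argument, and the two remaining terms differ by
the factor `ε`. -/
theorem isNull_of_not_injective {ν : (Fin w → Fin n) → F} (hν : IsAlternating ν)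
    {y : Fin (w + 1) → Fin n} (hy : ¬ Function.Injective y) (f : Fin n → F) :
    IsNull fun k => signedMinor ν y k * f (y k) := by
  obtain ⟨i, j, hij, hne⟩ := Function.not_injective_iff.1 hy
  have hcomp : y ∘ swap i j = y := by
    funext k
    rw [Function.comp_apply]
    rcases eq_or_ne k i with rfl | hi
    · rw [swap_apply_left, hij]
    rcases eq_or_ne k j with rfl | hj
    · rw [swap_apply_right, hij]
    rw [swap_apply_of_ne_of_ne hi hj]
  refine isNull_of_pair hne ?_ ?_
  · have := hν.signedMinor_comp y (swap i j) i
    rw [hcomp, swap_apply_left, Perm.sign_swap hne] at this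
    rw [this, hij]
    simp [signElt, mul_assoc]
  · intro k hki hkj
    by_contra h
    have hinj := hν.injective _ (signedMinor_ne_zero.1 (left_ne_zero_of_mul h))
    obtain ⟨i', rfl⟩ := Fin.exists_succAbove_eq hki.symm
    obtain ⟨j', rfl⟩ := Fin.exists_succAbove_eq hkj.symm
    exact hne (congrArg _ (hinj hij))

theorem orth_iff_isNull_signedMinor {ν : (Fin w → Fin n) → F} {f X Y : Fin n → F}
    {y : Fin (w + 1) → Fin n} (hy : Function.Injective y) (a b : Fˣ)
    (hX : ∀ e, X e = b * τ (f e)) (hY : ∀ i, Y (y i) = a * signedMinor ν y i)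
    (hY0 : ∀ e, e ∉ Set.range y → Y e = 0) :
    Orth τ X Y ↔ IsNull fun k => signedMinor ν y k * f (y k) := by
  have h1 : Orth τ X Y ↔ IsNull fun i => X (y i) * τ (Y (y i)) :=
    (isNull_comp_injective hy fun e he => by rw [hY0 e he, map_zero, mul_zero]).symm
  have hc : (b : F) * τ a ≠ 0 := mul_ne_zero b.ne_zero ((map_ne_zero _).2 a.ne_zero)
  rw [h1, ← isNull_map τ (f := fun k => signedMinor ν y k * f (y k)),
    ← isNull_unit_mul (Units.mk0 _ hc) (f := fun k => τ (signedMinor ν y k * f (y k)))]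
  have : ∀ i, X (y i) * τ (Y (y i)) =
      (Units.mk0 _ hc : Fˣ) * τ (signedMinor ν y i * f (y i)) := by
    intro i
    rw [hX, hY, map_mul, map_mul, Units.val_mk0, mul_mul_mul_comm, mul_comm (τ (f _)),
      ← mul_assoc]
  simp only [this]

theorem pluckerFlagRelations_succ_iff {m : ℕ} {μ : (Fin (m + 1) → Fin n) → F}
    {ν : (Fin w → Fin n) → F} : PluckerFlagRelations μ ν ↔
      ∀ y x, IsNull fun k => signedMinor ν y k * μ (Fin.cons (y k) x) := by
  obtain ⟨e, he, -⟩ := exists_unit_eps (F := F)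
  have key : ∀ (y : Fin (w + 1) → Fin n) (x : Fin m → Fin n),
      (IsNull fun k : Fin (w + 1) => eps F ^ ((k : ℕ) + 1) * ν (fun i => y (k.succAbove i)) *
        μ (fun i => (Fin.cons (y k) x : Fin (m + 1) → Fin n) i)) ↔
      IsNull fun k => signedMinor ν y k * μ (Fin.cons (y k) x) := by
    intro y x
    rw [← isNull_unit_mul e (f := fun k => signedMinor ν y k * μ (Fin.cons (y k) x))]
    simp only [he, signedMinor, pow_succ', mul_assoc]
  constructor
  · intro h y x
    exact (key y x).1 (h m rfl y x)
  · intro h m' hm y x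
    obtain rfl : m = m' := Nat.succ.inj hm
    exact (key y x).2 (h y x)

theorem orth_circuitsOf_iff_pluckerFlagRelations (μ : GPFunction F n r) (ν : GPFunction F n w) :
    (∀ X ∈ circuitsOf (μ.dual τ), ∀ Y ∈ circuitsOf ν.toFun, Orth τ X Y) ↔
      PluckerFlagRelations μ.toFun ν.toFun := by
  cases r with
  | zero =>
    exact iff_of_true (fun X hX => absurd hX (μ.circuitsOf_dual_zero τ))
      (fun m hm => absurd hm (by omega))
  | succ m =>
    rw [pluckerFlagRelations_succ_iff]
    constructor
    -- Circuits and cocircuits see only injective `y` with a nonzero minor and `x` with some `μ (e,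
    -- x) ≠ 0`; all other relations hold trivially.
    · intro h y x
      by_cases hy : Function.Injective y
      swap
      · exact isNull_of_not_injective ν.isAlternating hy fun e => μ.toFun (Fin.cons e x)
      by_cases hν : ∃ k, signedMinor ν.toFun y k ≠ 0
      swap
      · push Not at hν
        exact isNull_of_forall_eq_zero fun k => by rw [hν, zero_mul]
      by_cases hμ : ∃ e, μ.toFun (Fin.cons e x) ≠ 0
      swap
      · push Not at hμ
        exact isNull_of_forall_eq_zero fun k => by rw [hμ, mul_zero]
      have hY : ∀ i, Function.extend y (signedMinor ν.toFun y) 0 (y i) =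
          ((1 : Fˣ) : F) * signedMinor ν.toFun y i := by
        intro i
        rw [hy.extend_apply, Units.val_one, one_mul]
      have hY0 : ∀ e, e ∉ Set.range y →
          Function.extend y (signedMinor ν.toFun y) 0 e = 0 :=
        fun e he => Function.extend_apply' _ _ _ he
      exact (orth_iff_isNull_signedMinor τ (f := fun e => μ.toFun (Fin.cons e x)) hy 1 1
        (fun e => rfl) hY hY0).1
        (h _ ((μ.mem_circuitsOf_dual_iff τ).2 ⟨x, 1, hμ, fun e => rfl⟩) _
          (ν.isAlternating.mem_circuitsOf_iff.2 ⟨y, 1, hy, hν, hY, hY0⟩))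
    · intro h X hX Y hY
      obtain ⟨x, b, -, hX⟩ := (μ.mem_circuitsOf_dual_iff τ).1 hX
      obtain ⟨y, a, hy, -, hY, hY0⟩ := ν.isAlternating.mem_circuitsOf_iff.1 hY
      exact (orth_iff_isNull_signedMinor τ hy a b hX hY hY0).2 (h y x)

end Orthogonality

/-! ### Quotients and covectors -/

section Matroid

variable {F : Type*} [Tract F] {n r w : ℕ} (τ : Involution F)

theorem PluckerFlagRelations.of_equiv {μ μ' : GPFunction F n r} {ν ν' : GPFunction F n w}
    (hμ : μ' ≈ μ) (hν : ν' ≈ ν) (h : PluckerFlagRelations μ.toFun ν.toFun) :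
    PluckerFlagRelations μ'.toFun ν'.toFun := by
  obtain ⟨a, ha⟩ := hμ
  obtain ⟨b, hb⟩ := hν
  intro m hm y x
  have := (isNull_unit_mul (b * a)).2 (h m hm y x)
  convert this using 2 with k
  rw [ha, hb, Units.val_mul, mul_left_comm (eps F ^ _), mul_mul_mul_comm]

namespace FMatroid

theorem isQuotientOf_of_represents {M N : FMatroid F n} {μ : GPFunction F n M.rank}
    {ν : GPFunction F n N.rank} (hμ : Represents μ) (hν : Represents ν)
    (h : PluckerFlagRelations μ.toFun ν.toFun) : M.IsQuotientOf N := fun _ _ hμ' hν' =>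
  h.of_equiv (Quotient.exact (hμ'.symm.trans hμ)) (Quotient.exact (hν'.symm.trans hν))

theorem isQuotientOf_refl (M : FMatroid F n) : M.IsQuotientOf M := by
  obtain ⟨φ, hφ⟩ := Quotient.exists_rep M.cls
  exact isQuotientOf_of_represents hφ.symm hφ.symm φ.plucker

theorem isQuotientOf_iff_cocircuits_orth_circuits {M N : FMatroid F n} :
    M.IsQuotientOf N ↔ ∀ X ∈ M.cocircuits τ, ∀ Y ∈ N.circuits, Orth τ X Y := by
  constructor
  · rintro h X ⟨μ, hμ, hX⟩ Y ⟨ν, hν, hY⟩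
    exact (orth_circuitsOf_iff_pluckerFlagRelations τ μ ν).2 (h μ ν hμ hν) X hX Y hY
  · intro h μ ν hμ hν
    exact (orth_circuitsOf_iff_pluckerFlagRelations τ μ ν).1
      fun X hX Y hY => h X ⟨μ, hμ, hX⟩ Y ⟨ν, hν, hY⟩

theorem cocircuits_subset_covectors (M : FMatroid F n) : M.cocircuits τ ⊆ M.covectors τ :=
  (isQuotientOf_iff_cocircuits_orth_circuits τ).1 M.isQuotientOf_refl

theorem isQuotientOf_of_covectors_subset {M N : FMatroid F n}
    (h : M.covectors τ ⊆ N.covectors τ) : M.IsQuotientOf N :=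
  (isQuotientOf_iff_cocircuits_orth_circuits τ).2
    ((M.cocircuits_subset_covectors τ).trans h)

/-- The quotient condition makes each circuit `Y` of `N` a vector of `M`; perfection then makes it
orthogonal to every covector of `M`. -/
theorem IsQuotientOf.covectors_subset {M N : FMatroid F n} (h : M.IsQuotientOf N)
    (hτ : IsPerfect τ) : M.covectors τ ⊆ N.covectors τ := fun X hX Y hY =>
  (orth_comm τ).1 <| hτ n M Y (fun Z hZ => (orth_comm τ).1
    ((isQuotientOf_iff_cocircuits_orth_circuits τ).1 h Z hZ Y hY)) X hX

end FMatroid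

theorem isFlagMatroid_of_covectors_subset {s : ℕ} {M : Fin s → FMatroid F n}
    (h : ∀ (i : ℕ) (hi : i + 1 < s),
      (M ⟨i, Nat.lt_of_succ_lt hi⟩).covectors τ ⊆ (M ⟨i + 1, hi⟩).covectors τ) :
    IsFlagMatroid M := by
  have key : ∀ (i j : ℕ) (hij : i ≤ j) (hj : j < s),
      (M ⟨i, hij.trans_lt hj⟩).covectors τ ⊆ (M ⟨j, hj⟩).covectors τ := by
    intro i j hij
    induction j, hij using Nat.le_induction with
    | base => exact fun _ => subset_rfl
    | succ j _ ih => exact fun hj => (ih (Nat.lt_of_succ_lt hj)).trans (h j hj)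
  exact fun i j hij => FMatroid.isQuotientOf_of_covectors_subset τ (key i j hij.le j.2)

end Matroid

end FlagMat

theorem theorem2p16 {F : Type*} [FlagMat.Tract F] (τ : FlagMat.Involution F) {n s : ℕ}
    (M : Fin s → FlagMat.FMatroid F n) :
    -- the chain of covector sets implies that the sequence is a flag matroid
    ((∀ (i : ℕ) (hi : i + 1 < s),
        (M ⟨i, by omega⟩).covectors τ ⊆ (M ⟨i + 1, hi⟩).covectors τ) →
      FlagMat.IsFlagMatroid M) ∧
    -- a flag matroid has consecutive quotients
    (FlagMat.IsFlagMatroid M →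
      ∀ (i : ℕ) (hi : i + 1 < s), (M ⟨i, by omega⟩).IsQuotientOf (M ⟨i + 1, hi⟩)) ∧
    -- over a perfect tract, consecutive quotients give the chain of covector sets
    (FlagMat.IsPerfect τ →
      (∀ (i : ℕ) (hi : i + 1 < s), (M ⟨i, by omega⟩).IsQuotientOf (M ⟨i + 1, hi⟩)) →
      ∀ (i : ℕ) (hi : i + 1 < s),
        (M ⟨i, by omega⟩).covectors τ ⊆ (M ⟨i + 1, hi⟩).covectors τ) ∧
    -- over a perfect tract, it suffices to check the consecutive Plücker flag relations
    (FlagMat.IsPerfect τ →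
      ∀ φ : (i : Fin s) → FlagMat.GPFunction F n (M i).rank,
        (∀ i, FlagMat.FMatroid.Represents (φ i)) →
        (FlagMat.IsFlagMatroid M ↔
          ∀ (i : ℕ) (hi : i + 1 < s),
            FlagMat.PluckerFlagRelations (φ ⟨i, by omega⟩).toFun (φ ⟨i + 1, hi⟩).toFun)) := by
  have hcov (hτ : FlagMat.IsPerfect τ)
      (h : ∀ (i : ℕ) (hi : i + 1 < s), (M ⟨i, by omega⟩).IsQuotientOf (M ⟨i + 1, hi⟩)) (i : ℕ)
      (hi : i + 1 < s) : (M ⟨i, by omega⟩).covectors τ ⊆ (M ⟨i + 1, hi⟩).covectors τ :=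
    (h i hi).covectors_subset τ hτ
  refine ⟨FlagMat.isFlagMatroid_of_covectors_subset τ,
    fun h i hi => h _ _ (Fin.mk_lt_mk.2 i.lt_succ_self), hcov, fun hτ φ hφ => ⟨?_, ?_⟩⟩
  · exact fun h i hi => h _ _ (Fin.mk_lt_mk.2 i.lt_succ_self) _ _ (hφ _) (hφ _)
  · exact fun h => FlagMat.isFlagMatroid_of_covectors_subset τ (hcov hτ fun i hi =>
      FlagMat.FMatroid.isQuotientOf_of_represents (hφ _) (hφ _) (h i hi))
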